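/- Work in $\mathbb{C}_\infty=\mathbb{C}\cup\{\infty\}$; circles include straight lines (circles through $\infty$), and two circles are tangent if they have exactly one common point. An oriented circle is a circle together with a choice of one of its two complementary regions, its interior (the region to the right of the direction of travel); $\mathbb{R}$ is oriented to the right, so its interior is the lower half plane. A Descartes quadruple consists of four mutually tangent oriented circles with disjoint interiors. An Apollonian circle packing is the collection of oriented circles obtained from three mutually tangent oriented circles of disjoint interiors by repeatedly adding all circles which complete three mutually tangent circles of disjoint interiors in the collection to a Descartes quadruple. The group $\mathrm{PGL}_2(\mathbb{Z}[i])$ acts on $\mathbb{C}_\infty$ by Möbius transformations, hence on (oriented) circles and on collections of them; a Gaussian circle is the image of $\mathbb{R}$ under an element of $\mathrm{PGL}_2(\mathbb{Z}[i])$. Let $$\Gamma=\left\langle\begin{pmatrix}1&0\\1&1\end{pmatrix},\begin{pmatrix}0&i\\i&1\end{pmatrix}\right\rangle\le \mathrm{PGL}_2(\mathbb{Z}[i]).$$ **Proposition.** Let $P$ be an Apollonian circle packing all of whose circles are Gaussian circles. Then the subgroup of $\mathrm{PGL}_2(\mathbb{Z}[i])$ consisting of the elements taking $P$ to itself is a conjugate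 of $\Gamma$; the elements taking the set of underlying unoriented circles of $P$ to itself form the same conjugate of $\Gamma$. Furthermore, the base quadruple, consisting of $\mathbb{R}$ (with interior the lower half plane), the line $\operatorname{Im} z=1$ (with interior $\operatorname{Im} z>1$), and the circles of radius $\tfrac12$ with centres $1+\tfrac i2$ and $\tfrac i2$ (with the open discs as interiors), is a Descartes quadruple; the collection of circles generated from it by the process above (the Apollonian strip packing) is an Apollonian circle packing; and the collection of images of the oriented circle $\mathbb{R}$ under $\Gamma$ is exactly the Apollonian strip packing. -/

import Mathlib

open scoped Pointwise MatrixGroups OnePoint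

namespace Apollonian

noncomputable section

/-- A matrix over `ℤ[i]` with unit determinant acts on `ℂ ∪ {∞}` by the Möbius transformation
`z ↦ (a z + b) / (c z + d)`; scalar matrices act trivially, so this is an action of
`PGL(2, ℤ[i])`. On sets of points and on sets of sets it acts elementwise. -/
def moebiusHom : PGL(2, GaussianInt) →* Equiv.Perm (OnePoint ℂ) :=
  Matrix.ProjGenLinGroup.lift
    ((MulAction.toPermHom (GL (Fin 2) ℂ) (OnePoint ℂ)).comp
      (Matrix.GeneralLinearGroup.map GaussianInt.toComplex)) (by
    ext u z
    have hu : GaussianInt.toComplex (u : GaussianInt) ≠ 0 := by simp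
    cases z with
    | infty => simp [OnePoint.smul_infty_eq_ite]
    | coe z => simp [OnePoint.smul_some_eq_ite, hu])

instance : MulAction PGL(2, GaussianInt) (OnePoint ℂ) :=
  MulAction.compHom (OnePoint ℂ) moebiusHom

/-- Inclusion of a set of complex numbers into `ℂ ∪ {∞}`. -/
abbrev inC (S : Set ℂ) : Set (OnePoint ℂ) := (fun z : ℂ ↦ (z : OnePoint ℂ)) '' S

/-- Candidates for oriented circles: a pair `(C, D)` where `C` is the underlying circle and `D`
is the side of `C` called the interior. A direction of travel along `C` amounts to
a choice of `D` (the interior is the region to the right). A Möbius transformation acts on both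
components; being an orientation-preserving map of the sphere, it carries the region
to the right of a directed circle to the region to the right of its image. -/
abbrev Pair : Type := Set (OnePoint ℂ) × Set (OnePoint ℂ)

/-- The circle with centre `c` and radius `r`, with the bounded side as interior. -/
def disc (c : ℂ) (r : ℝ) : Pair := (inC (Metric.sphere c r), inC (Metric.ball c r))

/-- The circle with centre `c` and radius `r`, with the outside (and `∞`) as interior. -/
def outside (c : ℂ) (r : ℝ) : Pair :=
  (inC (Metric.sphere c r), insert ∞ (inC (Metric.closedBall c r)ᶜ))

/-- The line `Re (conj a * z) = t` together with `∞`, with the open half plane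
`Re (conj a * z) > t` as interior. -/
def halfPlane (a : ℂ) (t : ℝ) : Pair :=
  (insert ∞ (inC {z | (starRingEnd ℂ a * z).re = t}), inC {z | t < (starRingEnd ℂ a * z).re})

/-- Oriented circles in `ℂ ∪ {∞}`; straight lines are circles through `∞`. -/
def IsOrientedCircle (C : Pair) : Prop :=
  (∃ (c : ℂ) (r : ℝ), 0 < r ∧ C = disc c r) ∨
  (∃ (c : ℂ) (r : ℝ), 0 < r ∧ C = outside c r) ∨
  (∃ (a : ℂ) (t : ℝ), a ≠ 0 ∧ C = halfPlane a t)

/-- `ℝ ∪ {∞}`, travelled to the right: the interior is the open lower half plane. -/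
def realLine : Pair := (insert ∞ (inC {z | z.im = 0}), inC {z | z.im < 0})

/-- Two circles are tangent if they have exactly one common point (two parallel lines are
tangent at `∞`). -/
def Tangent (C D : Pair) : Prop := ∃ p, C.1 ∩ D.1 = {p}

/-- Two oriented circles that are tangent and have disjoint interiors. -/
def Adjacent (C D : Pair) : Prop := Tangent C D ∧ Disjoint C.2 D.2

/-- Three mutually tangent oriented circles of disjoint interiors. -/
def IsTriple (A B C : Pair) : Prop :=
  IsOrientedCircle A ∧ IsOrientedCircle B ∧ IsOrientedCircle C ∧
  Adjacent A B ∧ Adjacent A C ∧ Adjacent B C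

/-- Descartes quadruples: four mutually tangent oriented circles of disjoint interiors. -/
def IsDescartesQuadruple (A B C D : Pair) : Prop :=
  IsTriple A B C ∧ IsOrientedCircle D ∧ Adjacent A D ∧ Adjacent B D ∧ Adjacent C D

/-- Membership in the collection obtained from `S` by repeatedly adding all oriented circles that
complete three mutually tangent circles of the collection, of disjoint interiors, to a
Descartes quadruple. -/
inductive Generated (S : Set Pair) : Pair → Prop
  | seed {C : Pair} : C ∈ S → Generated S C
  | complete {A B C D : Pair} : Generated S A → Generated S B → Generated S C →
      IsDescartesQuadruple A B C D → Generated S D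

/-- The collection of oriented circles generated by `S`. -/
def packing (S : Set Pair) : Set Pair := {C | Generated S C}

/-- Apollonian circle packings, grown from three mutually tangent circles of disjoint
interiors. -/
def IsApollonianPacking (P : Set Pair) : Prop :=
  ∃ A B C : Pair, IsTriple A B C ∧ P = packing {A, B, C}

/-- The underlying unoriented circles of a collection of oriented circles. -/
def circles (P : Set Pair) : Set (Set (OnePoint ℂ)) := Prod.fst '' P

/-- A circle is Gaussian if it is the image of `ℝ ∪ {∞}` under an element of `PGL(2, ℤ[i])`. -/
def IsGaussianCircle (C : Set (OnePoint ℂ)) : Prop :=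
  ∃ g : PGL(2, GaussianInt), C = g • realLine.1

/-- The Gaussian integer `i`. -/
def gi : GaussianInt := ⟨0, 1⟩

/-- The Möbius transformation `(1 0; 1 1)`. -/
def gen₁ : PGL(2, GaussianInt) :=
  Matrix.SpecialLinearGroup.toPGL ⟨!![1, 0; 1, 1], by simp [Matrix.det_fin_two]⟩

/-- The Möbius transformation `(0 i; i 1)`. -/
def gen₂ : PGL(2, GaussianInt) :=
  Matrix.SpecialLinearGroup.toPGL ⟨!![0, gi; gi, 1], by
    rw [Matrix.det_fin_two]; simp [gi, Zsqrtd.ext_iff]⟩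

/-- The group generated by `(1 0; 1 1)` and `(0 i; i 1)`. -/
def Gam : Subgroup PGL(2, GaussianInt) := Subgroup.closure {gen₁, gen₂}

/-- The circles of the base quadruple: the real line with the lower half plane as interior, -/
def base₁ : Pair := realLine

/-- the line `Im z = 1` with the region above it as interior, -/
def base₂ : Pair := halfPlane Complex.I 1

/-- the circle of curvature `2` and curvature-centre `2 + i`, -/
def base₃ : Pair := disc (1 + Complex.I / 2) (1 / 2)

/-- and the circle of curvature `2` and curvature-centre `i`. -/
def base₄ : Pair := disc (Complex.I / 2) (1 / 2)

/-- The Apollonian strip packing, seeded by the base quadruple. -/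
def stripPacking : Set Pair := packing {base₁, base₂, base₃, base₄}

end

end Apollonian

/-!
A normalised real form `a |z|² + 2 (x Re z + y Im z) + d` with `x² + y² - a d = 1` determines an
oriented circle: its zero set, with the side where the form is negative as interior
(`isOrientedCircle_iff`). The underlying circle determines the form up to sign
(`eq_or_eq_neg_of_circ_fst_eq`), and `PGL(2, ℤ[i])` acts by composition of forms with the inverse
matrix. In particular Gaussian circles have forms with integer coefficients and even `a`, `d`
(`exists_isIntegral_of_isGaussianCircle`).

The heart of the argument is rigidity (`exists_mem_Gam_of_isTriple`): if `ℝ`, `B`, `C` is a triple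
and `B`, `C` are Gaussian, then an element of `Gam` carries the base triple (`ℝ`, the line
`Im z = 1`, and the circle of radius `1/2` about `i/2`) to it. The group `Gam` contains
`PSL(2, ℤ)`, which moves the rational point of tangency of `ℝ` and `B` to `∞`. Then `B` becomes a
line `Im z = t` with `t` a positive integer, and `C` a circle of diameter `t` in the strip between.
Its curvature `2 / t` is an even integer, so `t = 1`, and integrality of the remaining coefficients
makes its centre an integer translate of `i/2`.

Rigidity has three consequences. Every packing of Gaussian circles is a translate of the strip
packing. The strip packing is the orbit of `ℝ` under `Gam`: its generators preserve the packing,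
and conversely three circles of the orbit in mutual contact may be assumed to be the base triple,
whose two completions are visibly in the orbit. Finally, a transformation fixing the oriented real
line moves the base triple to another triple of the same kind, so that it agrees with an element
of `Gam` on the base triple, hence everywhere, as only the identity fixes `0`, `i` and `∞`.

It follows that the stabiliser of the strip packing is `Gam`. For the unoriented circles it remains
to exclude that `z ↦ -z` preserves them. The generators of `Gam` permute four congruence classes of
forms, those of the base quadruple, and the line `Im z = -1` is in none of them with either
orientation.
-/

open scoped ComplexConjugate

namespace Apollonian

/-! ### Hermitian forms and their circles -/

/-- Coefficients of the real-valued Hermitian form `a |z|² + 2 (x Re z + y Im z) + d`. -/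
@[ext]
structure HForm where
  /-- The coefficient of `|z|²`, the curvature of the circle when the form is normalised. -/
  a : ℝ
  /-- Half the coefficient of `Re z`. -/
  x : ℝ
  /-- Half the coefficient of `Im z`. -/
  y : ℝ
  /-- The constant term. -/
  d : ℝ

namespace HForm

noncomputable section

/-- The value of the form in homogeneous coordinates `[u : v]`. -/
def hom (h : HForm) (u v : ℂ) : ℝ :=
  h.a * (u.re ^ 2 + u.im ^ 2) + 2 * (h.x * (u.re * v.re + u.im * v.im) +
    h.y * (u.im * v.re - u.re * v.im)) + h.d * (v.re ^ 2 + v.im ^ 2)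

/-- The value of the form at a point of the sphere, at `[z : 1]` for a complex number `z` and at
`[1 : 0]` for `∞`. Only its sign depends on the point alone. -/
def eval (h : HForm) (p : OnePoint ℂ) : ℝ := p.elim h.a (fun z ↦ h.hom z 1)

@[simp] lemma eval_infty (h : HForm) : h.eval ∞ = h.a := rfl

lemma eval_coe (h : HForm) (z : ℂ) : h.eval z = h.hom z 1 := rfl

lemma eval_mk (h : HForm) (u v : ℝ) :
    h.eval ((⟨u, v⟩ : ℂ) : OnePoint ℂ) =
      h.a * (u ^ 2 + v ^ 2) + 2 * (h.x * u + h.y * v) + h.d := by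
  rw [eval_coe]; simp [hom]

/-- Minus the determinant of the Hermitian matrix; it is `1` for the normalised form of a circle. -/
def discr (h : HForm) : ℝ := h.x ^ 2 + h.y ^ 2 - h.a * h.d

instance : Neg HForm := ⟨fun h ↦ ⟨-h.a, -h.x, -h.y, -h.d⟩⟩

@[simp] lemma neg_mk (a x y d : ℝ) : -(⟨a, x, y, d⟩ : HForm) = ⟨-a, -x, -y, -d⟩ := rfl

lemma eval_neg (h : HForm) (p : OnePoint ℂ) : (-h).eval p = -h.eval p := by
  cases p with
  | infty => rfl
  | coe z =>
    obtain ⟨a, x, y, d⟩ := h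
    rw [neg_mk, eval_coe, eval_coe]; simp only [hom]; ring

lemma discr_neg (h : HForm) : (-h).discr = h.discr := by
  obtain ⟨a, x, y, d⟩ := h
  simp [discr]

/-- The zero set of the form, together with the side on which it is negative. -/
def circ (h : HForm) : Pair := ({p | h.eval p = 0}, {p | h.eval p < 0})

/-- The form composed with the matrix `(p q; r s)`. -/
def pull (h : HForm) (p q r s : ℂ) : HForm where
  a := h.hom p r
  x := (h.a * p * conj q + (h.x - h.y * Complex.I) * p * conj s
    + (h.x + h.y * Complex.I) * conj q * r + h.d * r * conj s).re
  y := -(h.a * p * conj q + (h.x - h.y * Complex.I) * p * conj s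
    + (h.x + h.y * Complex.I) * conj q * r + h.d * r * conj s).im
  d := h.hom q s

lemma hom_pull (h : HForm) (p q r s u v : ℂ) :
    (h.pull p q r s).hom u v = h.hom (p * u + q * v) (r * u + s * v) := by
  simp [pull, hom]
  ring

lemma discr_pull (h : HForm) (p q r s : ℂ) :
    (h.pull p q r s).discr = Complex.normSq (p * s - q * r) * h.discr := by
  simp [pull, hom, discr, Complex.normSq_apply]
  ring

/-- The form at `[u : v]` is a positive multiple of its value at the point `u / v`. -/
lemma exists_hom_eq (h : HForm) (u v : ℂ) (huv : u ≠ 0 ∨ v ≠ 0) :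
    ∃ k > 0, h.hom u v = k * h.eval (if v = 0 then ∞ else ((u / v : ℂ) : OnePoint ℂ)) := by
  by_cases hv : v = 0
  · have hu : u ≠ 0 := by tauto
    refine ⟨Complex.normSq u, Complex.normSq_pos.2 hu, ?_⟩
    simp [hv, hom, Complex.normSq_apply]; ring
  · refine ⟨Complex.normSq v, Complex.normSq_pos.2 hv, ?_⟩
    obtain ⟨w, rfl⟩ : ∃ w, u = w * v := ⟨u / v, by field_simp⟩
    rw [if_neg hv, mul_div_cancel_right₀ _ hv, eval_coe]
    simp [hom, Complex.normSq_apply]; ring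

lemma eval_pull (h : HForm) (g : GL (Fin 2) ℂ) (p : OnePoint ℂ) :
    ∃ k > 0, (h.pull (g 0 0) (g 0 1) (g 1 0) (g 1 1)).eval p = k * h.eval (g • p) := by
  have hdet : g 0 0 * g 1 1 - g 0 1 * g 1 0 ≠ 0 := by
    have := g.det_ne_zero
    rwa [Matrix.det_fin_two] at this
  cases p with
  | infty =>
    rw [OnePoint.smul_infty_eq_ite]
    apply exists_hom_eq
    by_contra! hc
    simp [hc] at hdet
  | coe z =>
    rw [OnePoint.smul_some_eq_ite, eval_coe, hom_pull, mul_one, mul_one]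
    apply exists_hom_eq
    by_contra! hc
    have h1 : g 0 1 = - g 0 0 * z := by linear_combination hc.1
    have h2 : g 1 1 = - g 1 0 * z := by linear_combination hc.2
    exact hdet (by rw [h1, h2]; ring)

end

end HForm

open HForm

lemma mk_smul (g : GL (Fin 2) GaussianInt) (p : OnePoint ℂ) :
    (Matrix.ProjGenLinGroup.mk g : PGL(2, GaussianInt)) • p =
      Matrix.GeneralLinearGroup.map GaussianInt.toComplex g • p := rfl

/-- Möbius transformations act on circles by composition of forms with the inverse matrix. -/
lemma inv_mk_smul_circ (g : GL (Fin 2) GaussianInt) (h : HForm) :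
    (Matrix.ProjGenLinGroup.mk g : PGL(2, GaussianInt))⁻¹ • h.circ =
      (h.pull (g 0 0 : GaussianInt) (g 0 1 : GaussianInt) (g 1 0 : GaussianInt)
        (g 1 1 : GaussianInt)).circ := by
  have key (p : OnePoint ℂ) := h.eval_pull (Matrix.GeneralLinearGroup.map GaussianInt.toComplex g) p
  simp only [Matrix.GeneralLinearGroup.map_apply, ← mk_smul] at key
  refine Prod.ext ?_ ?_
  · ext p
    obtain ⟨k, hk, e⟩ := key p
    rw [Prod.smul_fst, Set.mem_inv_smul_set_iff]
    change h.eval _ = 0 ↔ eval _ p = 0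
    rw [e]; simp [hk.ne']
  · ext p
    obtain ⟨k, hk, e⟩ := key p
    rw [Prod.smul_snd, Set.mem_inv_smul_set_iff]
    change h.eval _ < 0 ↔ eval _ p < 0
    rw [e, mul_neg_iff]; constructor
    · intro h; exact Or.inl ⟨hk, h⟩
    · rintro (h | h)
      · exact h.2
      · exact absurd h.1 hk.not_gt

lemma normSq_det (g : GL (Fin 2) GaussianInt) :
    Complex.normSq ((g 0 0 : GaussianInt) * (g 1 1 : GaussianInt) -
      (g 0 1 : GaussianInt) * (g 1 0 : GaussianInt) : ℂ) = 1 := by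
  have h1 : IsUnit (g.val.det) := (Matrix.isUnit_iff_isUnit_det _).1 g.isUnit
  rw [Matrix.det_fin_two] at h1
  have h2 := (Zsqrtd.norm_eq_one_iff (d := -1)).2 h1
  have h3 := GaussianInt.intCast_real_norm (g 0 0 * g 1 1 - g 0 1 * g 1 0)
  rw [GaussianInt.toComplex_sub, GaussianInt.toComplex_mul, GaussianInt.toComplex_mul] at h3
  rw [← h3]
  have h4 : (0:ℤ) ≤ Zsqrtd.norm (g 0 0 * g 1 1 - g 0 1 * g 1 0) := GaussianInt.norm_nonneg _
  have : Zsqrtd.norm (g 0 0 * g 1 1 - g 0 1 * g 1 0) = 1 := by omega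
  rw [this]; simp

/-- Unit determinants have absolute value one, so normalised forms stay normalised. -/
lemma exists_smul_circ (g : PGL(2, GaussianInt)) (h : HForm) :
    ∃ h' : HForm, h'.discr = h.discr ∧ g • h.circ = h'.circ := by
  obtain ⟨g', hg'⟩ := Matrix.ProjGenLinGroup.mk_surjective g⁻¹
  refine ⟨_, ?_, by rw [← inv_inv g, ← hg', inv_mk_smul_circ]⟩
  rw [discr_pull, normSq_det, one_mul]

/-! ### Oriented circles as circles of normalised forms -/

lemma mem_inC_coe (S : Set ℂ) (z : ℂ) : (z : OnePoint ℂ) ∈ inC S ↔ z ∈ S := by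
  simp [inC]

/-- The normalised form of the disc with centre `c` and radius `r`. -/
noncomputable def discForm (c : ℂ) (r : ℝ) : HForm :=
  ⟨1 / r, -c.re / r, -c.im / r, (c.re ^ 2 + c.im ^ 2 - r ^ 2) / r⟩

/-- The normalised form of the half plane `Re (conj a * z) > t`. -/
noncomputable def halfPlaneForm (a : ℂ) (t : ℝ) : HForm :=
  ⟨0, -a.re / ‖a‖, -a.im / ‖a‖, 2 * t / ‖a‖⟩

lemma discr_discForm (c : ℂ) {r : ℝ} (hr : 0 < r) : (discForm c r).discr = 1 := by
  simp only [discr, discForm]; field_simp; ring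

lemma discr_halfPlaneForm {a : ℂ} (ha : a ≠ 0) (t : ℝ) : (halfPlaneForm a t).discr = 1 := by
  have h : ‖a‖ ^ 2 = a.re ^ 2 + a.im ^ 2 := by
    rw [← Complex.normSq_eq_norm_sq, Complex.normSq_apply]; ring
  have h0 : ‖a‖ ≠ 0 := norm_ne_zero_iff.2 ha
  simp only [discr, halfPlaneForm]; field_simp; rw [h]; ring

lemma eval_discForm (c : ℂ) {r : ℝ} (hr : 0 < r) (z : ℂ) :
    (discForm c r).eval z = (dist z c ^ 2 - r ^ 2) / r := by
  rw [Complex.dist_eq_re_im, Real.sq_sqrt (by positivity), eval_coe]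
  simp only [hom, discForm, Complex.one_re, Complex.one_im]; field_simp; ring

lemma eval_halfPlaneForm (a : ℂ) (t : ℝ) (z : ℂ) :
    (halfPlaneForm a t).eval z = 2 * (t - (conj a * z).re) / ‖a‖ := by
  rw [eval_coe]
  simp [hom, halfPlaneForm]; ring

lemma disc_eq_circ (c : ℂ) {r : ℝ} (hr : 0 < r) : disc c r = (discForm c r).circ := by
  have hi : (discForm c r).eval ∞ = 1 / r := rfl
  refine Prod.ext ?_ ?_ <;> ext p <;> cases p with
  | infty => simp [disc, circ, hi, hr.ne', hr.le]
  | coe z =>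
    simp only [disc, circ, mem_inC_coe, Set.mem_ofPred_eq, eval_discForm c hr, Metric.mem_sphere,
      Metric.mem_ball, div_eq_zero_iff, hr.ne', or_false, div_neg_iff, hr, hr.not_gt, and_true,
      and_false, false_or, sub_eq_zero, sub_neg]
    first
    | exact (sq_eq_sq₀ dist_nonneg hr.le).symm
    | exact (sq_lt_sq₀ dist_nonneg hr.le).symm

lemma outside_eq_circ (c : ℂ) {r : ℝ} (hr : 0 < r) : outside c r = (-discForm c r).circ := by
  have hi : (discForm c r).eval ∞ = 1 / r := rfl
  refine Prod.ext ?_ ?_ <;> ext p <;> cases p with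
  | infty => simp [outside, circ, hr, hr.ne', eval_neg, hi]
  | coe z =>
    simp only [outside, circ, mem_inC_coe, Set.mem_ofPred_eq, eval_neg, eval_discForm c hr,
      Metric.mem_sphere, Set.mem_insert_iff, OnePoint.coe_ne_infty, false_or, Set.mem_compl_iff,
      Metric.mem_closedBall, neg_eq_zero, div_eq_zero_iff, hr.ne', or_false, sub_eq_zero,
      Left.neg_neg_iff, div_pos_iff, hr, hr.not_gt, and_true, and_false, sub_pos, not_le]
    first
    | exact (sq_eq_sq₀ dist_nonneg hr.le).symm
    | exact (sq_lt_sq₀ hr.le dist_nonneg).symm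

lemma halfPlane_eq_circ {a : ℂ} (ha : a ≠ 0) (t : ℝ) :
    halfPlane a t = (halfPlaneForm a t).circ := by
  have hi : (halfPlaneForm a t).eval ∞ = 0 := rfl
  have h0 : 0 < ‖a‖ := norm_pos_iff.2 ha
  refine Prod.ext ?_ ?_ <;> ext p <;> cases p with
  | infty => simp [halfPlane, circ, hi]
  | coe z =>
    simp only [halfPlane, circ, Set.mem_ofPred_eq, Set.mem_insert_iff, OnePoint.coe_ne_infty,
      false_or, mem_inC_coe, eval_halfPlaneForm, div_eq_zero_iff, h0.ne', or_false, mul_eq_zero,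
      two_ne_zero, div_neg_iff, h0, h0.not_gt, and_true, and_false, sub_eq_zero]
    first
    | exact eq_comm
    | constructor <;> intro h <;> linarith

/-- Oriented circles are exactly the circles of normalised Hermitian forms. -/
lemma isOrientedCircle_iff (C : Pair) :
    IsOrientedCircle C ↔ ∃ h : HForm, h.discr = 1 ∧ C = h.circ := by
  constructor
  · rintro (⟨c, r, hr, rfl⟩ | ⟨c, r, hr, rfl⟩ | ⟨a, t, ha, rfl⟩)
    · exact ⟨_, discr_discForm c hr, disc_eq_circ c hr⟩
    · exact ⟨_, by rw [discr_neg, discr_discForm c hr], outside_eq_circ c hr⟩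
    · exact ⟨_, discr_halfPlaneForm ha t, halfPlane_eq_circ ha t⟩
  · rintro ⟨⟨a, x, y, d⟩, h1, rfl⟩
    simp only [discr] at h1
    rcases lt_trichotomy a 0 with ha | ha | ha
    · refine Or.inr (Or.inl ⟨⟨-x / a, -y / a⟩, -1 / a, div_pos_of_neg_of_neg (by simp) ha, ?_⟩)
      rw [outside_eq_circ _ (div_pos_of_neg_of_neg (by simp) ha)]
      have := ha.ne
      simp only [discForm, neg_mk]
      congr 2 <;> field_simp
      linear_combination -h1
    · subst ha
      have h2 : ‖(⟨-x, -y⟩ : ℂ)‖ = 1 := by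
        rw [← sq_eq_sq₀ (norm_nonneg _) zero_le_one, ← Complex.normSq_eq_norm_sq,
          Complex.normSq_apply]
        simp only; linear_combination h1
      have h3 : (⟨-x, -y⟩ : ℂ) ≠ 0 := by
        intro h; rw [h] at h2; simp at h2
      refine Or.inr (Or.inr ⟨⟨-x, -y⟩, d / 2, h3, ?_⟩)
      rw [halfPlane_eq_circ h3, halfPlaneForm, h2]
      congr 2 <;> simp
      ring
    · refine Or.inl ⟨⟨-x / a, -y / a⟩, 1 / a, by positivity, ?_⟩
      rw [disc_eq_circ _ (by positivity)]
      have := ha.ne'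
      simp only [discForm]
      congr 2 <;> field_simp
      linear_combination -h1

/-- The normalised form of the real line; the interior is the lower half plane. -/
def formR : HForm := ⟨0, 0, 1, 0⟩

lemma realLine_eq : realLine = formR.circ := by
  refine Prod.ext ?_ ?_ <;> ext p <;> cases p with
  | infty => simp [realLine, circ, formR]
  | coe z => simp [realLine, circ, formR, eval_coe, hom, mul_neg_iff]

lemma base₁_eq : base₁ = circ ⟨0, 0, 1, 0⟩ := realLine_eq

lemma base₂_eq : base₂ = circ ⟨0, 0, -1, 2⟩ := by
  rw [base₂, halfPlane_eq_circ Complex.I_ne_zero, halfPlaneForm]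
  simp

lemma base₃_eq : base₃ = circ ⟨2, -2, -1, 2⟩ := by
  rw [base₃, disc_eq_circ _ (by norm_num), discForm]
  norm_num

lemma base₄_eq : base₄ = circ ⟨2, 0, -1, 0⟩ := by
  rw [base₄, disc_eq_circ _ (by norm_num), discForm]
  norm_num

/-- Normalised forms with the same zero set agree up to sign. -/
lemma eq_or_eq_neg_of_circ_fst_eq {h h' : HForm} (h1 : h.discr = 1) (h1' : h'.discr = 1)
    (e : h.circ.1 = h'.circ.1) : h' = h ∨ h' = -h := by
  have key (p : OnePoint ℂ) : h.eval p = 0 → h'.eval p = 0 := fun hp ↦ by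
    have : p ∈ h.circ.1 := hp
    rw [e] at this; exact this
  obtain ⟨a, x, y, d⟩ := h
  obtain ⟨A, X, Y, D⟩ := h'
  have k (u v : ℝ) (huv : a * (u ^ 2 + v ^ 2) + 2 * (x * u + y * v) + d = 0) :
      A * (u ^ 2 + v ^ 2) + 2 * (X * u + Y * v) + D = 0 := by
    have := key ((⟨u, v⟩ : ℂ) : OnePoint ℂ)
    rw [eval_mk, eval_mk] at this
    exact this huv
  have hinf := key ∞
  simp only [eval_infty] at hinf
  simp only [discr] at h1 h1'
  -- The two forms are proportional; the factor is found from a few points of the common circle.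
  suffices hl : ∃ l : ℝ, A = l * a ∧ X = l * x ∧ Y = l * y ∧ D = l * d by
    obtain ⟨l, rfl, rfl, rfl, rfl⟩ := hl
    have : l * l = 1 := by linear_combination h1' - l ^ 2 * h1
    rcases mul_self_eq_one_iff.1 this with rfl | rfl <;> simp
  by_cases ha : a = 0
  · have hA := hinf ha
    subst ha hA
    have e0 := k (-d / 2 * x) (-d / 2 * y) (by linear_combination -d * h1)
    have e1 := k (-d / 2 * x - y) (-d / 2 * y + x) (by linear_combination -d * h1)
    have e2 : Y * x = X * y := by linear_combination (e1 - e0) / 2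
    refine ⟨X * x + Y * y, by ring, ?_, ?_, ?_⟩
    · linear_combination -X * h1 - y * e2
    · linear_combination -Y * h1 + x * e2
    · linear_combination e0
  · have p1 := k ((-x + 1) / a) (-y / a) (by field_simp; linear_combination -h1)
    have p2 := k ((-x - 1) / a) (-y / a) (by field_simp; linear_combination -h1)
    have p3 := k (-x / a) ((-y + 1) / a) (by field_simp; linear_combination -h1)
    have p4 := k (-x / a) ((-y - 1) / a) (by field_simp; linear_combination -h1)
    field_simp at p1 p2 p3 p4
    have q1 : X * a = A * x := by linear_combination (p1 - p2) / 4
    have q2 : Y * a = A * y := by linear_combination (p3 - p4) / 4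
    refine ⟨A / a, by field_simp, by field_simp; linear_combination q1,
      by field_simp; linear_combination q2, ?_⟩
    field_simp
    have q3 : a * (D * a - A * d) = 0 := by
      linear_combination p1 - 2 * (-x + 1) * q1 + 2 * y * q2 + A * h1
    have := (mul_eq_zero.1 q3).resolve_left ha
    linear_combination this

/-! ### Invariance under Möbius transformations -/

section Equivariance

variable (g : PGL(2, GaussianInt))

lemma isOrientedCircle_smul {C : Pair} (hC : IsOrientedCircle C) : IsOrientedCircle (g • C) := by
  rw [isOrientedCircle_iff] at *
  obtain ⟨h, h1, rfl⟩ := hC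
  obtain ⟨h', e, e'⟩ := exists_smul_circ g h
  exact ⟨h', e.trans h1, e'⟩

lemma adjacent_smul {C D : Pair} (h : Adjacent C D) : Adjacent (g • C) (g • D) := by
  obtain ⟨⟨p, hp⟩, hd⟩ := h
  refine ⟨⟨g • p, ?_⟩, ?_⟩
  · rw [Prod.smul_fst, Prod.smul_fst, ← Set.smul_set_inter, hp, Set.smul_set_singleton]
  · rw [Prod.smul_snd, Prod.smul_snd]
    exact (Set.disjoint_smul_set).2 hd

lemma isTriple_smul {A B C : Pair} (h : IsTriple A B C) : IsTriple (g • A) (g • B) (g • C) :=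
  ⟨isOrientedCircle_smul g h.1, isOrientedCircle_smul g h.2.1, isOrientedCircle_smul g h.2.2.1,
    adjacent_smul g h.2.2.2.1, adjacent_smul g h.2.2.2.2.1, adjacent_smul g h.2.2.2.2.2⟩

lemma isDescartesQuadruple_smul {A B C D : Pair} (h : IsDescartesQuadruple A B C D) :
    IsDescartesQuadruple (g • A) (g • B) (g • C) (g • D) :=
  ⟨isTriple_smul g h.1, isOrientedCircle_smul g h.2.1, adjacent_smul g h.2.2.1,
    adjacent_smul g h.2.2.2.1, adjacent_smul g h.2.2.2.2⟩

lemma isGaussianCircle_smul {C : Set (OnePoint ℂ)} (h : IsGaussianCircle C) :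
    IsGaussianCircle (g • C) := by
  obtain ⟨k, rfl⟩ := h
  exact ⟨g * k, by rw [mul_smul]⟩

lemma packing_subset {S T : Set Pair} (h : S ⊆ packing T) : packing S ⊆ packing T := by
  intro C hC
  induction hC with
  | seed hC => exact h hC
  | complete _ _ _ hq hA hB hC => exact Generated.complete hA hB hC hq

lemma smul_mem_packing {S : Set Pair} {C : Pair} (hC : C ∈ packing S) :
    g • C ∈ packing (g • S) := by
  induction hC with
  | seed hC => exact Generated.seed (Set.smul_mem_smul_set hC)
  | complete _ _ _ hq hA hB hC =>
    exact Generated.complete hA hB hC (isDescartesQuadruple_smul g hq)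

lemma smul_packing (S : Set Pair) : g • packing S = packing (g • S) := by
  apply Set.Subset.antisymm
  · rintro _ ⟨C, hC, rfl⟩
    exact smul_mem_packing g hC
  · intro C hC
    rw [Set.mem_smul_set_iff_inv_smul_mem]
    have := smul_mem_packing g⁻¹ hC
    rwa [inv_smul_smul] at this

end Equivariance

/-! ### Tangency and Descartes quadruples -/

lemma adjacent_circ_iff (h h' : HForm) : Adjacent h.circ h'.circ ↔
    (∃ p, (h.eval p = 0 ∧ h'.eval p = 0) ∧ ∀ q, h.eval q = 0 → h'.eval q = 0 → q = p) ∧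
      ∀ p, h.eval p < 0 → ¬ h'.eval p < 0 := by
  rw [Adjacent, Tangent, Set.disjoint_left]
  refine and_congr (exists_congr fun p ↦ ?_) Iff.rfl
  rw [Set.eq_singleton_iff_unique_mem]
  exact and_congr Iff.rfl ⟨fun H q h1 h2 ↦ H q ⟨h1, h2⟩, fun H q hq ↦ H q hq.1 hq.2⟩

lemma Adjacent.symm {C D : Pair} (h : Adjacent C D) : Adjacent D C :=
  ⟨by obtain ⟨p, hp⟩ := h.1; exact ⟨p, by rw [Set.inter_comm, hp]⟩, h.2.symm⟩

/-- Two circles are adjacent when the sum of their forms is positive away from a common zero. -/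
lemma adjacent_circ_of_add_pos {h h' : HForm} (p : OnePoint ℂ) (hp : h.eval p = 0)
    (hp' : h'.eval p = 0) (H : ∀ q ≠ p, 0 < h.eval q + h'.eval q) :
    Adjacent h.circ h'.circ := by
  rw [adjacent_circ_iff]
  refine ⟨⟨p, ⟨hp, hp'⟩, fun q h1 h2 ↦ ?_⟩, fun q h1 h2 ↦ ?_⟩
  · by_contra hq
    linarith [H q hq]
  · by_cases hq : q = p
    · subst hq; linarith
    · linarith [H q hq]

/-- The case in which the sum of the two forms is `k |z - c|²`. -/
lemma adjacent_circ_of_add_eq {h h' : HForm} (c₁ c₂ k : ℝ) (hk : 0 < k)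
    (hc : h.eval ((⟨c₁, c₂⟩ : ℂ) : OnePoint ℂ) = 0) (ha : h.a + h'.a = k)
    (hx : h.x + h'.x = -k * c₁) (hy : h.y + h'.y = -k * c₂)
    (hd : h.d + h'.d = k * (c₁ ^ 2 + c₂ ^ 2)) : Adjacent h.circ h'.circ := by
  have key (u v : ℝ) : h.eval ((⟨u, v⟩ : ℂ) : OnePoint ℂ) + h'.eval ((⟨u, v⟩ : ℂ) : OnePoint ℂ) =
      k * ((u - c₁) ^ 2 + (v - c₂) ^ 2) := by
    rw [eval_mk, eval_mk]
    linear_combination (u ^ 2 + v ^ 2) * ha + 2 * u * hx + 2 * v * hy + hd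
  refine adjacent_circ_of_add_pos _ hc ?_ fun q hq ↦ ?_
  · have := key c₁ c₂
    rw [hc] at this; simpa using this
  · cases q with
    | infty => rw [eval_infty, eval_infty, ha]; exact hk
    | coe z =>
      obtain ⟨u, v⟩ := z
      rw [key]
      by_cases hu : u = c₁
      · have hv : v ≠ c₂ := by rintro rfl; exact hq (by rw [hu])
        have := sub_ne_zero.2 hv
        positivity
      · have := sub_ne_zero.2 hu
        positivity

lemma isOrientedCircle_circ {h : HForm} (h1 : h.discr = 1) : IsOrientedCircle h.circ :=
  (isOrientedCircle_iff _).2 ⟨h, h1, rfl⟩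

lemma isDescartesQuadruple_base : IsDescartesQuadruple base₁ base₂ base₃ base₄ := by
  rw [base₁_eq, base₂_eq, base₃_eq, base₄_eq]
  refine ⟨⟨isOrientedCircle_circ ?_, isOrientedCircle_circ ?_, isOrientedCircle_circ ?_,
    ?_, ?_, ?_⟩, isOrientedCircle_circ ?_, ?_, ?_, ?_⟩
  · norm_num [discr]
  · norm_num [discr]
  · norm_num [discr]
  · refine adjacent_circ_of_add_pos ∞ rfl rfl fun q hq ↦ ?_
    cases q with
    | infty => exact absurd rfl hq
    | coe z => rw [eval_coe, eval_coe]; simp [hom]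
  · apply adjacent_circ_of_add_eq 1 0 2 <;> norm_num [eval_mk]
  · apply adjacent_circ_of_add_eq 1 1 2 <;> norm_num [eval_mk]
  · norm_num [discr]
  · apply adjacent_circ_of_add_eq 0 0 2 <;> norm_num [eval_mk]
  · apply adjacent_circ_of_add_eq 0 1 2 <;> norm_num [eval_mk]
  · apply adjacent_circ_of_add_eq (1 / 2) (1 / 2) 4 <;> norm_num [eval_mk]

lemma isTriple_base : IsTriple base₁ base₂ base₄ := by
  obtain ⟨⟨h1, h2, -, h12, -, -⟩, h4, h14, h24, -⟩ := isDescartesQuadruple_base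
  exact ⟨h1, h2, h4, h12, h14, h24⟩

lemma isDescartesQuadruple_base' : IsDescartesQuadruple base₁ base₂ base₄ base₃ := by
  obtain ⟨⟨h1, h2, h3, h12, h13, h23⟩, h4, h14, h24, h34⟩ := isDescartesQuadruple_base
  exact ⟨⟨h1, h2, h4, h12, h14, h24⟩, h3, h13, h23, h34.symm⟩

/-- Tangency to the real line: the form restricted to `ℝ` has a double root. -/
lemma sq_eq_of_adjacent_real {h : HForm} (h1 : h.discr = 1) (had : Adjacent formR.circ h.circ) :
    h.x ^ 2 = h.a * h.d ∧ h.y ^ 2 = 1 := by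
  suffices hx : h.x ^ 2 = h.a * h.d from ⟨hx, by simp only [discr] at h1; linarith⟩
  obtain ⟨⟨p, ⟨hp, hp'⟩, huniq⟩, -⟩ := (adjacent_circ_iff _ _).1 had
  have hR (u v : ℝ) : formR.eval ((⟨u, v⟩ : ℂ) : OnePoint ℂ) = 2 * v := by
    rw [eval_mk]; simp [formR]
  obtain ⟨a, x, y, d⟩ := h
  simp only
  by_cases ha : a = 0
  · have e := huniq ∞ rfl ha
    by_contra hx
    have hx0 : x ≠ 0 := by
      rintro rfl; simp [ha] at hx
    have := huniq ((⟨-d / (2 * x), 0⟩ : ℂ) : OnePoint ℂ) (by rw [hR]; simp)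
      (by rw [eval_mk, ha]; field_simp; ring)
    rw [← e] at this
    exact OnePoint.coe_ne_infty _ this
  · cases p with
    | infty => exact absurd hp' ha
    | coe z =>
      obtain ⟨u, v⟩ := z
      rw [hR] at hp
      obtain rfl : v = 0 := by linarith
      rw [eval_mk] at hp'
      simp only at hp'
      -- The other root of the quadratic polynomial is also a common point.
      have := huniq ((⟨-2 * x / a - u, 0⟩ : ℂ) : OnePoint ℂ) (by rw [hR]; simp)
        (by rw [eval_mk]; simp only; field_simp; linear_combination a * hp')
      rw [OnePoint.coe_eq_coe, Complex.mk.injEq] at this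
      have hu : x = -a * u := by
        have := this.1; field_simp at this; linarith
      subst hu
      linear_combination -a * hp'

/-- The normalised form of the half plane `Im z > t`. -/
def lineForm (t : ℝ) : HForm := ⟨0, 0, -1, 2 * t⟩

/-- A circle in the gap between `ℝ` and the line `Im z = t` that is tangent to both. -/
lemma of_adjacent_real_line {h : HForm} {t : ℝ} (ht : 0 < t) (h1 : h.discr = 1)
    (hR : Adjacent formR.circ h.circ) (hL : Adjacent (lineForm t).circ h.circ) :
    0 < h.a ∧ h.y = -1 ∧ h.a * t = 2 ∧ h.x ^ 2 = h.a * h.d := by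
  obtain ⟨hx, hy⟩ := sq_eq_of_adjacent_real h1 hR
  have eR (u v : ℝ) : formR.eval ((⟨u, v⟩ : ℂ) : OnePoint ℂ) = 2 * v := by
    rw [eval_mk]; simp [formR]
  have eL (u v : ℝ) : (lineForm t).eval ((⟨u, v⟩ : ℂ) : OnePoint ℂ) = 2 * (t - v) := by
    rw [eval_mk]; simp [lineForm]; ring
  obtain ⟨-, dR⟩ := (adjacent_circ_iff _ _).1 hR
  obtain ⟨⟨p, ⟨hp, hp'⟩, huniq⟩, dL⟩ := (adjacent_circ_iff _ _).1 hL
  obtain ⟨a, x, y, d⟩ := h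
  simp only at hx hy ⊢
  have hy' : y = 1 ∨ y = -1 := mul_self_eq_one_iff.1 (by rw [← hy]; ring)
  have hd := neg_abs_le d
  have hd' := le_abs_self d
  rcases lt_trichotomy a 0 with ha | rfl | ha
  · -- The outside of a circle meets the lower half plane, at `-x / a + 3 i / a` for example.
    refine absurd ?_ (dR ((⟨-x / a, 3 / a⟩ : ℂ) : OnePoint ℂ) ?_)
    · have e : a * ((-x / a) ^ 2 + (3 / a) ^ 2) + 2 * (x * (-x / a) + y * (3 / a)) + d =
          (9 + 6 * y) / a := by
        have := ha.ne
        field_simp; linear_combination -hx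
      rw [eval_mk, e]
      apply div_neg_of_pos_of_neg _ ha
      rcases hy' with rfl | rfl <;> norm_num
    · rw [eR]
      have : 3 / a < 0 := div_neg_of_pos_of_neg (by norm_num) ha
      linarith
  · -- A horizontal half plane meets either the lower half plane or `Im z > t`.
    have hx0 : x = 0 := by simpa using hx
    subst hx0
    rcases hy' with rfl | rfl
    · refine absurd ?_ (dR ((⟨0, -(|d| + 1)⟩ : ℂ) : OnePoint ℂ) ?_)
      · rw [eval_mk]; linarith [abs_nonneg d]
      · rw [eR]; linarith [abs_nonneg d]
    · refine absurd ?_ (dL ((⟨0, t + |d| + 1⟩ : ℂ) : OnePoint ℂ) ?_)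
      · rw [eval_mk]; linarith [abs_nonneg d]
      · rw [eL]; linarith [abs_nonneg d]
  · cases p with
    | infty => exact absurd hp' ha.ne'
    | coe z =>
      obtain ⟨u, v⟩ := z
      rw [eL] at hp
      obtain rfl : v = t := by linarith
      rw [eval_mk] at hp'
      simp only at hp'
      have := huniq ((⟨-2 * x / a - u, v⟩ : ℂ) : OnePoint ℂ) (by rw [eL]; simp)
        (by rw [eval_mk]; simp only; field_simp; linear_combination a * hp')
      rw [OnePoint.coe_eq_coe, Complex.mk.injEq] at this
      have hu : x = -a * u := by
        have := this.1; field_simp at this; linarith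
      subst hu
      have h2 : a * v * (a * v + 2 * y) = 0 := by linear_combination a * hp' + hx
      have h3 : a * v + 2 * y = 0 := (mul_eq_zero.1 h2).resolve_left (by positivity)
      have h4 : y = -1 := by
        refine hy'.resolve_left ?_
        rintro rfl
        have : 0 < a * v := by positivity
        linarith
      exact ⟨ha, h4, by rw [h4] at h3; linarith, hx⟩

lemma base₂_eq_lineForm : base₂ = (lineForm 1).circ := by
  rw [base₂_eq, lineForm]; norm_num

/-- The triple `ℝ`, `Im z = 1`, `|z - i/2| = 1/2` has exactly two completions to a Descartes
quadruple. -/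
lemma completion_base {D : Pair} (hD : IsDescartesQuadruple base₁ base₂ base₄ D) :
    D = base₃ ∨ D = circ ⟨2, 2, -1, 2⟩ := by
  obtain ⟨-, hc, hR, hL, h4⟩ := hD
  obtain ⟨h, h1, rfl⟩ := (isOrientedCircle_iff _).1 hc
  rw [base₂_eq_lineForm] at hL
  rw [base₄_eq] at h4
  obtain ⟨ha, hy, hat, hx⟩ := of_adjacent_real_line one_pos h1 (by rwa [base₁_eq] at hR) hL
  obtain ⟨⟨p, ⟨hp, hp'⟩, huniq⟩, -⟩ := (adjacent_circ_iff _ _).1 h4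
  obtain ⟨a, x, y, d⟩ := h
  simp only at ha hy hat hx
  obtain rfl : a = 2 := by linarith
  subst hy
  cases p with
  | infty => norm_num at hp
  | coe z =>
    obtain ⟨u, v⟩ := z
    rw [eval_mk] at hp hp'
    simp only at hp hp'
    -- Reflection in `Im z = 1/2` preserves both circles, hence fixes their common point.
    have hv := huniq ((⟨u, 1 - v⟩ : ℂ) : OnePoint ℂ)
      (by rw [eval_mk]; simp only; linear_combination hp)
      (by rw [eval_mk]; simp only; linear_combination hp')
    rw [OnePoint.coe_eq_coe, Complex.mk.injEq] at hv
    obtain rfl : v = 1 / 2 := by linarith [hv.2]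
    have hu : x * (4 * u + x) = 0 := by linear_combination 2 * hp' - 2 * hp + hx
    rcases mul_eq_zero.1 hu with rfl | hu
    · obtain rfl : d = 0 := by linarith
      have e0 := huniq ((⟨0, 0⟩ : ℂ) : OnePoint ℂ) (by rw [eval_mk]; norm_num)
        (by rw [eval_mk]; norm_num)
      rw [OnePoint.coe_eq_coe, Complex.mk.injEq] at e0
      norm_num at e0
    · obtain rfl : x = -4 * u := by linarith
      have hu2 : (2 * u) * (2 * u) = 1 := by linear_combination 2 * hp
      obtain rfl : d = 2 := by linear_combination -hx / 2 + 2 * hu2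
      rcases mul_self_eq_one_iff.1 hu2 with hu | hu
      · left
        rw [base₃_eq, show -4 * u = -2 by linarith]
      · right
        rw [show -4 * u = 2 by linarith]

/-! ### Generators, the modular group and integral forms -/

lemma inv_toPGL_smul_circ (M : SL(2, GaussianInt)) (h : HForm) :
    (Matrix.SpecialLinearGroup.toPGL M)⁻¹ • h.circ =
      (h.pull (M 0 0 : GaussianInt) (M 0 1 : GaussianInt) (M 1 0 : GaussianInt)
        (M 1 1 : GaussianInt)).circ :=
  inv_mk_smul_circ (Matrix.SpecialLinearGroup.toGL M) h

lemma inv_gen₁_smul_circ (a x y d : ℝ) :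
    gen₁⁻¹ • circ ⟨a, x, y, d⟩ = circ ⟨a + 2 * x + d, x + d, y, d⟩ := by
  refine (inv_toPGL_smul_circ _ _).trans (congrArg circ ?_)
  ext <;> simp [pull, hom]

lemma gen₁_smul_circ (a x y d : ℝ) :
    gen₁ • circ ⟨a, x, y, d⟩ = circ ⟨a - 2 * x + d, x - d, y, d⟩ := by
  rw [smul_eq_iff_eq_inv_smul, inv_gen₁_smul_circ]
  congr 2 <;> ring

lemma inv_gen₂_smul_circ (a x y d : ℝ) :
    gen₂⁻¹ • circ ⟨a, x, y, d⟩ = circ ⟨d, x, -y - d, a + 2 * y + d⟩ := by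
  refine (inv_toPGL_smul_circ _ _).trans (congrArg circ ?_)
  ext <;> simp [pull, hom, gi, GaussianInt.toComplex_def]
  ring

lemma gen₂_smul_circ (a x y d : ℝ) :
    gen₂ • circ ⟨a, x, y, d⟩ = circ ⟨a + 2 * y + d, x, -y - a, a⟩ := by
  rw [smul_eq_iff_eq_inv_smul, inv_gen₂_smul_circ]
  congr 2 <;> ring

/-- The rotation `z ↦ -z`, which reverses the orientation of the real line. -/
noncomputable def rot : PGL(2, GaussianInt) :=
  Matrix.SpecialLinearGroup.toPGL ⟨!![gi, 0; 0, -gi], by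
    rw [Matrix.det_fin_two]; simp [gi, Zsqrtd.ext_iff]⟩

lemma inv_rot_smul_circ (a x y d : ℝ) :
    rot⁻¹ • circ ⟨a, x, y, d⟩ = circ ⟨a, -x, -y, d⟩ := by
  refine (inv_toPGL_smul_circ _ _).trans (congrArg circ ?_)
  ext <;> simp [pull, hom, gi, GaussianInt.toComplex_def]

/-- The map from `SL(2, ℤ)` to `PGL(2, ℤ[i])`; its image preserves the oriented real line. -/
noncomputable def modularHom : SL(2, ℤ) →* PGL(2, GaussianInt) :=
  Matrix.SpecialLinearGroup.toPGL.comp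
    (Matrix.SpecialLinearGroup.map (Int.castRingHom GaussianInt))

lemma inv_modularHom_smul_circ (M : SL(2, ℤ)) (a x y d : ℝ) :
    (modularHom M)⁻¹ • circ ⟨a, x, y, d⟩ =
      circ ⟨a * M 0 0 ^ 2 + 2 * x * M 0 0 * M 1 0 + d * M 1 0 ^ 2,
        a * M 0 0 * M 0 1 + x * (M 0 0 * M 1 1 + M 0 1 * M 1 0) + d * M 1 0 * M 1 1,
        y, a * M 0 1 ^ 2 + 2 * x * M 0 1 * M 1 1 + d * M 1 1 ^ 2⟩ := by
  have hdet : (M 0 0 * M 1 1 - M 0 1 * M 1 0 : ℝ) = 1 := by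
    have := M.det_coe
    rw [Matrix.det_fin_two] at this
    exact_mod_cast this
  rw [modularHom, MonoidHom.comp_apply, inv_toPGL_smul_circ]
  congr 1
  ext
  · simp [pull, hom]; ring
  · simp [pull, hom]; ring
  · simp [pull, hom]; linear_combination y * hdet
  · simp [pull, hom]; ring

lemma gen₁_mem : gen₁ ∈ Gam := Subgroup.subset_closure (by simp)

lemma gen₂_mem : gen₂ ∈ Gam := Subgroup.subset_closure (by simp)

/-- The integral matrix of the first generator. -/
def lowerUnipotent : SL(2, ℤ) := ⟨!![1, 0; 1, 1], by simp⟩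

lemma modularHom_lowerUnipotent : modularHom lowerUnipotent = gen₁ := by
  refine congrArg Matrix.SpecialLinearGroup.toPGL (Matrix.SpecialLinearGroup.ext _ _ fun i j ↦ ?_)
  fin_cases i <;> fin_cases j <;> decide

lemma modularHom_T : modularHom ModularGroup.T = gen₂⁻¹ * gen₁ * gen₂ := by
  rw [mul_assoc, eq_inv_mul_iff_mul_eq]
  refine (map_mul Matrix.SpecialLinearGroup.toPGL _ _).symm.trans (Eq.trans ?_
    (map_mul Matrix.SpecialLinearGroup.toPGL _ _))
  refine congrArg Matrix.SpecialLinearGroup.toPGL (Matrix.SpecialLinearGroup.ext _ _ fun i j ↦ ?_)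
  fin_cases i <;> fin_cases j <;> decide

/-- `Gam` contains `PSL(2, ℤ)`: the first generator and its conjugate `z ↦ z + 1` by the second
one generate it. -/
lemma modularHom_mem (M : SL(2, ℤ)) : modularHom M ∈ Gam := by
  have hT : modularHom ModularGroup.T ∈ Gam := by
    rw [modularHom_T]
    exact mul_mem (mul_mem (inv_mem gen₂_mem) gen₁_mem) gen₂_mem
  have hS : modularHom ModularGroup.S ∈ Gam := by
    have : ModularGroup.S =
        ModularGroup.T⁻¹ * lowerUnipotent * ModularGroup.T⁻¹ := by decide
    rw [this, map_mul, map_mul, modularHom_lowerUnipotent, map_inv]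
    exact mul_mem (mul_mem (inv_mem hT) gen₁_mem) (inv_mem hT)
  have hM : M ∈ Subgroup.closure {ModularGroup.S, ModularGroup.T} := by
    rw [SpecialLinearGroup.SL2Z_generators]; trivial
  have hle : Subgroup.closure {ModularGroup.S, ModularGroup.T} ≤ Gam.comap modularHom := by
    rw [Subgroup.closure_le]
    rintro _ (rfl | rfl)
    · exact hS
    · exact hT
  exact hle hM

/-- Forms with integer coefficients and even diagonal coefficients. -/
def HForm.IsIntegral (h : HForm) : Prop := ∃ k m n l : ℤ, h = ⟨2 * k, m, n, 2 * l⟩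

lemma HForm.IsIntegral.neg {h : HForm} (hh : h.IsIntegral) : (-h).IsIntegral := by
  obtain ⟨k, m, n, l, rfl⟩ := hh
  exact ⟨-k, -m, -n, -l, by simp⟩

lemma HForm.IsIntegral.pull {h : HForm} (hh : h.IsIntegral) (p q r s : GaussianInt) :
    (h.pull p q r s).IsIntegral := by
  obtain ⟨k, m, n, l, rfl⟩ := hh
  refine ⟨k * (p.re ^ 2 + p.im ^ 2) + (m * (p.re * r.re + p.im * r.im) +
      n * (p.im * r.re - p.re * r.im)) + l * (r.re ^ 2 + r.im ^ 2),
    2 * k * (p.re * q.re + p.im * q.im) + m * (p.re * s.re + p.im * s.im) +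
      n * (p.im * s.re - p.re * s.im) + m * (q.re * r.re + q.im * r.im) -
      n * (q.re * r.im - q.im * r.re) + 2 * l * (r.re * s.re + r.im * s.im),
    -(2 * k * (p.im * q.re - p.re * q.im) + m * (p.im * s.re - p.re * s.im) -
      n * (p.re * s.re + p.im * s.im) + m * (q.re * r.im - q.im * r.re) +
      n * (q.re * r.re + q.im * r.im) + 2 * l * (r.im * s.re - r.re * s.im)),
    k * (q.re ^ 2 + q.im ^ 2) + (m * (q.re * s.re + q.im * s.im) +
      n * (q.im * s.re - q.re * s.im)) + l * (s.re ^ 2 + s.im ^ 2), ?_⟩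
  ext <;> simp [HForm.pull, hom] <;> ring

lemma exists_isIntegral_smul_circ (g : PGL(2, GaussianInt)) {h : HForm} (hh : h.IsIntegral) :
    ∃ h' : HForm, h'.IsIntegral ∧ h'.discr = h.discr ∧ g • h.circ = h'.circ := by
  obtain ⟨g', hg'⟩ := Matrix.ProjGenLinGroup.mk_surjective g⁻¹
  refine ⟨_, hh.pull _ _ _ _, ?_, by rw [← inv_inv g, ← hg', inv_mk_smul_circ]⟩
  rw [discr_pull, normSq_det, one_mul]

/-- A Gaussian circle has an integral normalised form, whatever its orientation. -/
lemma exists_isIntegral_of_isGaussianCircle {C : Pair} (hC : IsOrientedCircle C)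
    (hg : IsGaussianCircle C.1) : ∃ h : HForm, h.IsIntegral ∧ h.discr = 1 ∧ C = h.circ := by
  obtain ⟨h, h1, rfl⟩ := (isOrientedCircle_iff C).1 hC
  obtain ⟨g, hg⟩ := hg
  obtain ⟨h', hint, h1', e⟩ := exists_isIntegral_smul_circ g
    (h := formR) ⟨0, 0, 1, 0, by simp [formR]⟩
  have hR : formR.discr = 1 := by simp [discr, formR]
  rw [← Prod.smul_fst, realLine_eq, e] at hg
  refine ⟨h, ?_, h1, rfl⟩
  rcases eq_or_eq_neg_of_circ_fst_eq (h1'.trans hR) h1 hg.symm with rfl | rfl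
  · exact hint
  · exact hint.neg

/-! ### Rigidity of Gaussian triples -/

lemma modularHom_smul_base₁ (M : SL(2, ℤ)) : modularHom M • base₁ = base₁ := by
  rw [smul_eq_iff_eq_inv_smul, base₁_eq, inv_modularHom_smul_circ]
  simp

/-- A primitive zero of an integral binary quadratic form of discriminant zero. -/
lemma exists_isCoprime_root {k m l : ℤ} (h : m ^ 2 = 4 * k * l) :
    ∃ p q : ℤ, IsCoprime p q ∧ 2 * k * p ^ 2 + 2 * m * p * q + 2 * l * q ^ 2 = 0 := by
  by_cases hk : k = 0
  · have hm : m = 0 := by simpa [hk] using h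
    exact ⟨1, 0, isCoprime_one_left, by simp [hk]⟩
  · have hpos : 0 < Int.gcd (-m) (2 * k) := Int.gcd_pos_of_ne_zero_right _ (by omega)
    obtain ⟨p, q, hpq, hp, hq⟩ := Int.exists_gcd_one hpos
    refine ⟨p, q, Int.isCoprime_iff_gcd_eq_one.2 hpq, ?_⟩
    set c : ℤ := ((Int.gcd (-m) (2 * k) : ℕ) : ℤ)
    have hc : c ≠ 0 := by simp only [c]; exact_mod_cast hpos.ne'
    have e : c ^ 2 * (2 * k * p ^ 2 + 2 * m * p * q + 2 * l * q ^ 2) = 0 := by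
      have e1 : c ^ 2 * (2 * k * p ^ 2 + 2 * m * p * q + 2 * l * q ^ 2) =
        2 * k * (p * c) ^ 2 + 2 * m * (p * c) * (q * c) + 2 * l * (q * c) ^ 2 := by ring
      rw [e1, ← hp, ← hq]
      linear_combination (-2 * k) * h
    exact (mul_eq_zero.1 e).resolve_left (pow_ne_zero 2 hc)

/-- The case of `exists_mem_Gam_of_isTriple` in which the second circle is a line. -/
lemma exists_mem_Gam_of_line {m n l : ℤ} {C : Pair}
    (h : IsTriple base₁ (circ ⟨0, m, n, 2 * l⟩) C)
    (h1 : discr ⟨0, m, n, 2 * l⟩ = 1) (hC : IsGaussianCircle C.1) :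
    ∃ γ ∈ Gam, γ • base₁ = base₁ ∧ γ • base₂ = circ ⟨0, m, n, 2 * l⟩ ∧ γ • base₄ = C := by
  obtain ⟨-, -, hoC, hRB, hRC, hBC⟩ := h
  rw [base₁_eq] at hRB hRC
  change Adjacent formR.circ _ at hRB hRC
  obtain ⟨hm, hn⟩ := sq_eq_of_adjacent_real h1 hRB
  simp only [zero_mul, ne_eq, OfNat.ofNat_ne_zero, not_false_eq_true, pow_eq_zero_iff,
    Int.cast_eq_zero] at hm hn
  subst hm
  obtain ⟨⟨p, ⟨hp, hp'⟩, huniq⟩, hdisj⟩ := (adjacent_circ_iff _ _).1 hRB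
  have hn' : (n : ℝ) = 1 ∨ (n : ℝ) = -1 := mul_self_eq_one_iff.1 (by rw [← hn]; ring)
  have eR (u v : ℝ) : formR.eval ((⟨u, v⟩ : ℂ) : OnePoint ℂ) = 2 * v := by
    rw [eval_mk]; simp [formR]
  -- Disjointness of interiors excludes the lower half planes.
  have hn1 : (n : ℝ) = -1 := by
    refine hn'.resolve_left fun hn1 ↦ ?_
    refine hdisj ((⟨0, -(|(l : ℝ)| + 1)⟩ : ℂ) : OnePoint ℂ) ?_ ?_
    · rw [eR]; linarith [abs_nonneg (l : ℝ)]
    · rw [eval_mk, hn1]; simp only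
      linarith [abs_nonneg (l : ℝ), le_abs_self (l : ℝ)]
  have hl : (0 : ℝ) < l := by
    rcases lt_trichotomy (l : ℝ) 0 with hl | hl | hl
    · refine absurd ?_ (hdisj ((⟨0, l / 2⟩ : ℂ) : OnePoint ℂ) ?_)
      · rw [eval_mk, hn1]; simp only; linarith
      · rw [eR]; linarith
    · have e0 := huniq ((⟨0, 0⟩ : ℂ) : OnePoint ℂ) (by rw [eR]; simp)
        (by rw [eval_mk, hn1, hl]; simp)
      have e1 := huniq ((⟨1, 0⟩ : ℂ) : OnePoint ℂ) (by rw [eR]; simp)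
        (by rw [eval_mk, hn1, hl]; simp)
      rw [← e0, OnePoint.coe_eq_coe, Complex.mk.injEq] at e1
      norm_num at e1
    · exact hl
  have hB : (⟨0, (0 : ℤ), n, 2 * l⟩ : HForm) = lineForm l := by
    rw [lineForm, hn1, Int.cast_zero]
  rw [hB] at hBC ⊢
  obtain ⟨h, ⟨k', m', n', l', rfl⟩, hd, rfl⟩ := exists_isIntegral_of_isGaussianCircle hoC hC
  obtain ⟨ha, hy, hat, hx⟩ := of_adjacent_real_line hl hd hRC hBC
  simp only at ha hy hat hx
  -- Integrality forces the strip to have width one and the circle to have radius `1/2`.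
  have hkl : k' * l = 1 := by
    have : (k' : ℝ) * l = 1 := by linarith
    exact_mod_cast this
  have hk0 : 0 < k' := by
    have : (0 : ℝ) < k' := by linarith
    exact_mod_cast this
  obtain rfl : k' = 1 := Int.eq_one_of_dvd_one hk0.le ⟨l, hkl.symm⟩
  obtain rfl : l = 1 := by omega
  have hx' : m' ^ 2 = 2 * (2 * l') := by
    rw [Int.cast_one] at hx
    have : (m' : ℝ) ^ 2 = 2 * (2 * l') := by rw [hx]; ring
    exact_mod_cast this
  obtain ⟨j, rfl⟩ : (2 : ℤ) ∣ m' := Int.prime_two.dvd_of_dvd_pow (n := 2) ⟨_, hx'⟩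
  obtain rfl : l' = j ^ 2 := by linarith
  let τ : SL(2, ℤ) := ⟨!![1, -j; 0, 1], by simp⟩
  have t00 : τ 0 0 = 1 := rfl
  have t01 : τ 0 1 = -j := rfl
  have t10 : τ 1 0 = 0 := rfl
  have t11 : τ 1 1 = 1 := rfl
  refine ⟨modularHom τ, modularHom_mem τ, modularHom_smul_base₁ τ, ?_, ?_⟩
  · rw [smul_eq_iff_eq_inv_smul, lineForm, base₂_eq, inv_modularHom_smul_circ, t00, t01, t10, t11]
    congr 2 <;> simp
  · rw [smul_eq_iff_eq_inv_smul, base₄_eq, inv_modularHom_smul_circ, t00, t01, t10, t11, hy]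
    congr 2 <;> push_cast <;> ring

/-- A triple of Gaussian circles containing the oriented real line is the image of the base triple
under an element of `Gam` fixing the real line. -/
lemma exists_mem_Gam_of_isTriple {B C : Pair} (h : IsTriple base₁ B C)
    (hB : IsGaussianCircle B.1) (hC : IsGaussianCircle C.1) :
    ∃ γ ∈ Gam, γ • base₁ = base₁ ∧ γ • base₂ = B ∧ γ • base₄ = C := by
  obtain ⟨hb, ⟨k, m, n, l, rfl⟩, h1, rfl⟩ := exists_isIntegral_of_isGaussianCircle h.2.1 hB
  have hR := h.2.2.2.1
  rw [base₁_eq] at hR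
  obtain ⟨hm, -⟩ := sq_eq_of_adjacent_real h1 hR
  have hm' : m ^ 2 = 4 * k * l := by
    have : (m : ℝ) ^ 2 = 4 * k * l := by rw [hm]; ring
    exact_mod_cast this
  obtain ⟨p, q, hpq, hroot⟩ := exists_isCoprime_root hm'
  -- Move the point of tangency `p / q` with the real line to `∞`.
  obtain ⟨σ, rfl, rfl⟩ := hpq.exists_SL2_col 0
  have hT := isTriple_smul (modularHom σ)⁻¹ h
  have hC' := isGaussianCircle_smul (modularHom σ)⁻¹ hC
  have hd : ((modularHom σ)⁻¹ • circ ⟨2 * k, m, n, 2 * l⟩ : Pair) =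
      circ ⟨0, (2 * k * σ 0 0 * σ 0 1 + m * (σ 0 0 * σ 1 1 + σ 0 1 * σ 1 0) +
        2 * l * σ 1 0 * σ 1 1 : ℤ), n,
        2 * (k * σ 0 1 ^ 2 + m * σ 0 1 * σ 1 1 + l * σ 1 1 ^ 2 : ℤ)⟩ := by
    have hr : (2 * k * σ 0 0 ^ 2 + 2 * m * σ 0 0 * σ 1 0 + 2 * l * σ 1 0 ^ 2 : ℝ) = 0 := by
      exact_mod_cast hroot
    rw [inv_modularHom_smul_circ, hr]
    congr 2 <;> push_cast <;> ring
  rw [inv_smul_eq_iff.2 (modularHom_smul_base₁ σ).symm, hd] at hT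
  have hdet : (σ 0 0 * σ 1 1 - σ 0 1 * σ 1 0 : ℝ) = 1 := by
    have := σ.det_coe
    rw [Matrix.det_fin_two] at this
    exact_mod_cast this
  obtain ⟨γ, hγ, e1, e2, e4⟩ := exists_mem_Gam_of_line hT (by
    have hr : (2 * k * σ 0 0 ^ 2 + 2 * m * σ 0 0 * σ 1 0 + 2 * l * σ 1 0 ^ 2 : ℝ) = 0 := by
      exact_mod_cast hroot
    simp only [discr] at h1 hm ⊢
    push_cast
    linear_combination h1 + (σ 0 0 * σ 1 1 - σ 0 1 * σ 1 0 + 1 : ℝ) * (m ^ 2 - 4 * k * l) * hdet +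
      (2 * k * σ 0 1 ^ 2 + 2 * m * σ 0 1 * σ 1 1 + 2 * l * σ 1 1 ^ 2 : ℝ) * hr) hC'
  refine ⟨modularHom σ * γ, mul_mem (modularHom_mem σ) hγ, ?_, ?_, ?_⟩
  · rw [mul_smul, e1, modularHom_smul_base₁]
  · rw [mul_smul, e2, ← hd, smul_inv_smul]
  · rw [mul_smul, e4, smul_inv_smul]

/-! ### The strip packing as an orbit -/

lemma gen₁_smul_base₁ : gen₁ • base₁ = base₁ := by
  rw [base₁_eq, gen₁_smul_circ]; norm_num

lemma gen₁_smul_base₂ : gen₁ • base₂ = base₃ := by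
  rw [base₂_eq, base₃_eq, gen₁_smul_circ]; norm_num

lemma gen₁_smul_base₄ : gen₁ • base₄ = base₄ := by
  rw [base₄_eq, gen₁_smul_circ]; norm_num

lemma inv_gen₁_smul_base₂ : gen₁⁻¹ • base₂ = circ ⟨2, 2, -1, 2⟩ := by
  rw [base₂_eq, inv_gen₁_smul_circ]; norm_num

lemma gen₂_smul_base₁ : gen₂ • base₁ = base₄ := by
  rw [base₁_eq, base₄_eq, gen₂_smul_circ]; norm_num

lemma gen₂_smul_base₄ : gen₂ • base₄ = base₂ := by
  rw [base₂_eq, base₄_eq, gen₂_smul_circ]; norm_num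

lemma gen₂_smul_base₂ : gen₂ • base₂ = base₁ := by
  rw [base₁_eq, base₂_eq, gen₂_smul_circ]; norm_num

/-- The fourth circle of the base quadruple is already generated by the other three. -/
lemma stripPacking_eq : stripPacking = packing {base₁, base₂, base₄} := by
  have h1 : Generated {base₁, base₂, base₄} base₁ := .seed (by simp)
  have h2 : Generated {base₁, base₂, base₄} base₂ := .seed (by simp)
  have h4 : Generated {base₁, base₂, base₄} base₄ := .seed (by simp)
  apply Set.Subset.antisymm
  · apply packing_subset
    rintro _ (rfl | rfl | rfl | rfl)
    · exact h1
    · exact h2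
    · exact .complete h1 h2 h4 isDescartesQuadruple_base'
    · exact h4
  · apply packing_subset
    rintro _ (rfl | rfl | rfl) <;> exact .seed (by simp)

lemma base₁_mem : base₁ ∈ stripPacking := .seed (by simp)

lemma base₂_mem : base₂ ∈ stripPacking := .seed (by simp)

lemma base₃_mem : base₃ ∈ stripPacking := .seed (by simp)

lemma base₄_mem : base₄ ∈ stripPacking := .seed (by simp)

/-- The second completion of the base triple is the image of the line `Im z = 1` under `gen₁⁻¹`,
which carries `base₁`, `base₃`, `base₄` to the base triple. -/
lemma inv_gen₁_smul_base₂_mem : gen₁⁻¹ • base₂ ∈ stripPacking := by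
  refine .complete base₁_mem base₂_mem base₄_mem ?_
  obtain ⟨⟨h1, h2, h3, h12, h13, h23⟩, h4, h14, h24, h34⟩ := isDescartesQuadruple_base
  have := isDescartesQuadruple_smul gen₁⁻¹ (A := base₁) (B := base₃) (C := base₄) (D := base₂)
    ⟨⟨h1, h3, h4, h13, h14, h34⟩, h2, h12, h23.symm, h24.symm⟩
  rwa [inv_smul_eq_iff.2 gen₁_smul_base₁.symm, inv_smul_eq_iff.2 gen₁_smul_base₂.symm,
    inv_smul_eq_iff.2 gen₁_smul_base₄.symm] at this

lemma mem_stabilizer_of_smul_mem {G α : Type*} [Group G] [MulAction G α] {g : G} {X : Set α}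
    (h : ∀ x ∈ X, g • x ∈ X) (h' : ∀ x ∈ X, g⁻¹ • x ∈ X) : g ∈ MulAction.stabilizer G X := by
  rw [MulAction.mem_stabilizer_iff]
  apply Set.Subset.antisymm
  · rintro _ ⟨x, hx, rfl⟩
    exact h x hx
  · intro x hx
    rw [Set.mem_smul_set_iff_inv_smul_mem]
    exact h' x hx

lemma smul_mem_stripPacking {g : PGL(2, GaussianInt)} (h1 : g • base₁ ∈ stripPacking)
    (h2 : g • base₂ ∈ stripPacking) (h4 : g • base₄ ∈ stripPacking) {C : Pair}
    (hC : C ∈ stripPacking) : g • C ∈ stripPacking := by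
  rw [stripPacking_eq] at hC
  have := smul_mem_packing g hC
  refine packing_subset ?_ this
  rintro _ ⟨D, (rfl | rfl | rfl), rfl⟩
  · exact h1
  · exact h2
  · exact h4

lemma Gam_le_stabilizer_stripPacking :
    Gam ≤ MulAction.stabilizer PGL(2, GaussianInt) stripPacking := by
  rw [Gam, Subgroup.closure_le]
  rintro _ (rfl | rfl)
  · refine mem_stabilizer_of_smul_mem (fun C hC ↦ smul_mem_stripPacking ?_ ?_ ?_ hC)
      (fun C hC ↦ smul_mem_stripPacking ?_ ?_ ?_ hC)
    · rw [gen₁_smul_base₁]; exact base₁_mem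
    · rw [gen₁_smul_base₂]; exact base₃_mem
    · rw [gen₁_smul_base₄]; exact base₄_mem
    · rw [inv_smul_eq_iff.2 gen₁_smul_base₁.symm]; exact base₁_mem
    · exact inv_gen₁_smul_base₂_mem
    · rw [inv_smul_eq_iff.2 gen₁_smul_base₄.symm]; exact base₄_mem
  · refine mem_stabilizer_of_smul_mem (fun C hC ↦ smul_mem_stripPacking ?_ ?_ ?_ hC)
      (fun C hC ↦ smul_mem_stripPacking ?_ ?_ ?_ hC)
    · rw [gen₂_smul_base₁]; exact base₄_mem
    · rw [gen₂_smul_base₂]; exact base₁_mem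
    · rw [gen₂_smul_base₄]; exact base₂_mem
    · rw [inv_smul_eq_iff.2 gen₂_smul_base₂.symm]; exact base₂_mem
    · rw [inv_smul_eq_iff.2 gen₂_smul_base₄.symm]; exact base₄_mem
    · rw [inv_smul_eq_iff.2 gen₂_smul_base₁.symm]; exact base₁_mem

lemma isGaussianCircle_smul_base₁ (g : PGL(2, GaussianInt)) : IsGaussianCircle (g • base₁).1 :=
  ⟨g, rfl⟩

/-- The strip packing is the orbit of the oriented real line under `Gam`. -/
lemma exists_smul_eq_of_mem_stripPacking {D : Pair} (hD : D ∈ stripPacking) :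
    ∃ γ ∈ Gam, D = γ • base₁ := by
  have h2 : gen₂⁻¹ • base₁ = base₂ := inv_smul_eq_iff.2 gen₂_smul_base₂.symm
  rw [stripPacking_eq] at hD
  induction hD with
  | seed hC =>
    rcases hC with rfl | rfl | rfl
    · exact ⟨1, one_mem _, by simp⟩
    · exact ⟨gen₂⁻¹, inv_mem gen₂_mem, h2.symm⟩
    · exact ⟨gen₂, gen₂_mem, gen₂_smul_base₁.symm⟩
  | @complete A B C D _ _ _ hq hA hB hC =>
    obtain ⟨α, hα, rfl⟩ := hA
    obtain ⟨β, hβ, rfl⟩ := hB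
    obtain ⟨δ, hδ, rfl⟩ := hC
    have hq' := isDescartesQuadruple_smul α⁻¹ hq
    rw [inv_smul_smul, smul_smul, smul_smul] at hq'
    obtain ⟨γ, hγ, e1, e2, e4⟩ := exists_mem_Gam_of_isTriple hq'.1
      (isGaussianCircle_smul_base₁ _) (isGaussianCircle_smul_base₁ _)
    have hq'' := isDescartesQuadruple_smul γ⁻¹ hq'
    rw [inv_smul_eq_iff.2 e1.symm, inv_smul_eq_iff.2 e2.symm, inv_smul_eq_iff.2 e4.symm] at hq''
    have hD : ∃ ε ∈ Gam, γ⁻¹ • α⁻¹ • D = ε • base₁ := by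
      rcases completion_base hq'' with e | e
      · exact ⟨gen₁ * gen₂⁻¹, mul_mem gen₁_mem (inv_mem gen₂_mem), by
          rw [e, mul_smul, h2, gen₁_smul_base₂]⟩
      · exact ⟨gen₁⁻¹ * gen₂⁻¹, mul_mem (inv_mem gen₁_mem) (inv_mem gen₂_mem), by
          rw [e, mul_smul, h2, inv_gen₁_smul_base₂]⟩
    obtain ⟨ε, hε, e⟩ := hD
    refine ⟨α * (γ * ε), mul_mem hα (mul_mem hγ hε), ?_⟩
    rw [mul_smul, mul_smul, ← e, smul_inv_smul, smul_inv_smul]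

lemma smul_mem_of_mem_Gam {γ : PGL(2, GaussianInt)} (hγ : γ ∈ Gam) {C : Pair}
    (hC : C ∈ stripPacking) : γ • C ∈ stripPacking := by
  have := MulAction.mem_stabilizer_iff.1 (Gam_le_stabilizer_stripPacking hγ)
  rw [← this]
  exact Set.smul_mem_smul_set hC

/-! ### Stabilisers -/

/-- A transformation preserving two tangent circles fixes their point of tangency. -/
lemma smul_eq_of_tangent {g : PGL(2, GaussianInt)} {C D : Pair} (h : Tangent C D)
    (hC : g • C = C) (hD : g • D = D) {p : OnePoint ℂ} (hpC : p ∈ C.1) (hpD : p ∈ D.1) :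
    g • p = p := by
  obtain ⟨q, hq⟩ := h
  obtain rfl : p = q := by
    have : p ∈ C.1 ∩ D.1 := ⟨hpC, hpD⟩
    rwa [hq] at this
  have : g • p ∈ C.1 ∩ D.1 :=
    ⟨by rw [← hC]; exact Set.smul_mem_smul_set hpC, by rw [← hD]; exact Set.smul_mem_smul_set hpD⟩
  rwa [hq] at this

/-- Only the identity fixes the three circles of the base triple, because it fixes their points of
tangency `0`, `i` and `∞`. -/
lemma eq_one_of_smul_base {g : PGL(2, GaussianInt)} (h1 : g • base₁ = base₁)
    (h2 : g • base₂ = base₂) (h4 : g • base₄ = base₄) : g = 1 := by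
  obtain ⟨-, -, -, t12, t14, t24⟩ := isTriple_base
  have ginf : g • (∞ : OnePoint ℂ) = ∞ := by
    refine smul_eq_of_tangent t12.1 h1 h2 ?_ ?_
    · rw [base₁_eq]; rfl
    · rw [base₂_eq]; rfl
  have g0 : g • ((⟨0, 0⟩ : ℂ) : OnePoint ℂ) = ((⟨0, 0⟩ : ℂ) : OnePoint ℂ) := by
    refine smul_eq_of_tangent t14.1 h1 h4 ?_ ?_
    · rw [base₁_eq]; change eval _ _ = 0; rw [eval_mk]; simp
    · rw [base₄_eq]; change eval _ _ = 0; rw [eval_mk]; simp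
  have gI : g • ((⟨0, 1⟩ : ℂ) : OnePoint ℂ) = ((⟨0, 1⟩ : ℂ) : OnePoint ℂ) := by
    refine smul_eq_of_tangent t24.1 h2 h4 ?_ ?_
    · rw [base₂_eq]; change eval _ _ = 0; rw [eval_mk]; simp
    · rw [base₄_eq]; change eval _ _ = 0; rw [eval_mk]; simp
  obtain ⟨M, rfl⟩ := Matrix.ProjGenLinGroup.mk_surjective g
  have z0 : (⟨0, 0⟩ : ℂ) = 0 := rfl
  have zI : (⟨0, 1⟩ : ℂ) = Complex.I := rfl
  rw [mk_smul, OnePoint.smul_infty_eq_self_iff, Matrix.GeneralLinearGroup.map_apply,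
    GaussianInt.toComplex_eq_zero] at ginf
  have hdet := normSq_det M
  rw [ginf, GaussianInt.toComplex_zero, mul_zero, sub_zero, map_mul] at hdet
  have h11 : GaussianInt.toComplex (M 1 1) ≠ 0 := by
    intro h; rw [h] at hdet; simp at hdet
  rw [mk_smul, OnePoint.smul_some_eq_ite] at g0 gI
  simp only [Matrix.GeneralLinearGroup.map_apply, ginf, GaussianInt.toComplex_zero, zero_mul,
    zero_add, if_false, OnePoint.coe_eq_coe, z0, zI, mul_zero, div_eq_zero_iff, h11,
    or_false] at g0 gI
  rw [g0, add_zero, div_eq_iff h11, mul_comm, mul_right_inj' Complex.I_ne_zero,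
    GaussianInt.toComplex_inj] at gI
  rw [GaussianInt.toComplex_eq_zero] at g0
  rw [Matrix.ProjGenLinGroup.mk_eq_one, Subgroup.mem_center_iff]
  refine fun N ↦ Matrix.GeneralLinearGroup.ext fun i j ↦ ?_
  simp only [Units.val_mul, Matrix.mul_apply, Fin.sum_univ_two]
  fin_cases i <;> fin_cases j <;> simp [ginf, g0, gI, mul_comm]

/-- The stabiliser of the oriented real line lies in `Gam`: it moves the base triple to another
triple of Gaussian circles containing the real line. -/
lemma mem_Gam_of_smul_base₁ {g : PGL(2, GaussianInt)} (h : g • base₁ = base₁) : g ∈ Gam := by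
  have ht := isTriple_smul g isTriple_base
  rw [h] at ht
  have h2 : base₂ = gen₂⁻¹ • base₁ := (inv_smul_eq_iff.2 gen₂_smul_base₂.symm).symm
  have h4 : base₄ = gen₂ • base₁ := gen₂_smul_base₁.symm
  obtain ⟨γ, hγ, e1, e2, e4⟩ := exists_mem_Gam_of_isTriple ht
    (by rw [h2, smul_smul]; exact isGaussianCircle_smul_base₁ _)
    (by rw [h4, smul_smul]; exact isGaussianCircle_smul_base₁ _)
  have : γ⁻¹ * g = 1 := by
    apply eq_one_of_smul_base
    · rw [mul_smul, h, inv_smul_eq_iff, e1]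
    · rw [mul_smul, inv_smul_eq_iff, e2]
    · rw [mul_smul, inv_smul_eq_iff, e4]
  rwa [← inv_mul_eq_one.1 this]

/-- The integral circles whose coefficients lie, modulo `(8, 4, 4, 8)`, in one of the four classes
of the base quadruple. -/
def congruentToBase : Set Pair :=
  {C | ∃ a x y d : ℤ, C = circ ⟨a, x, y, d⟩ ∧ x ^ 2 + y ^ 2 - a * d = 1 ∧
    (a % 8 = 0 ∧ x % 4 = 0 ∧ y % 4 = 1 ∧ d % 8 = 0 ∨
      a % 8 = 0 ∧ x % 4 = 0 ∧ y % 4 = 3 ∧ d % 8 = 2 ∨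
      a % 8 = 2 ∧ x % 4 = 2 ∧ y % 4 = 3 ∧ d % 8 = 2 ∨
      a % 8 = 2 ∧ x % 4 = 0 ∧ y % 4 = 3 ∧ d % 8 = 0)}

lemma Gam_le_stabilizer_congruentToBase :
    Gam ≤ MulAction.stabilizer PGL(2, GaussianInt) congruentToBase := by
  rw [Gam, Subgroup.closure_le]
  rintro _ (rfl | rfl)
  · refine mem_stabilizer_of_smul_mem ?_ ?_
    · rintro _ ⟨a, x, y, d, rfl, h1, h⟩
      refine ⟨a - 2 * x + d, x - d, y, d, ?_, by linear_combination h1, ?_⟩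
      · rw [gen₁_smul_circ]; push_cast; rfl
      · rcases h with h | h | h | h
        exacts [.inl (by omega), .inr (.inr (.inl (by omega))),
          .inr (.inl (by omega)), .inr (.inr (.inr (by omega)))]
    · rintro _ ⟨a, x, y, d, rfl, h1, h⟩
      refine ⟨a + 2 * x + d, x + d, y, d, ?_, by linear_combination h1, ?_⟩
      · rw [inv_gen₁_smul_circ]; push_cast; rfl
      · rcases h with h | h | h | h
        exacts [.inl (by omega), .inr (.inr (.inl (by omega))),
          .inr (.inl (by omega)), .inr (.inr (.inr (by omega)))]
  · refine mem_stabilizer_of_smul_mem ?_ ?_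
    · rintro _ ⟨a, x, y, d, rfl, h1, h⟩
      refine ⟨a + 2 * y + d, x, -y - a, a, ?_, by linear_combination h1, ?_⟩
      · rw [gen₂_smul_circ]; push_cast; rfl
      · rcases h with h | h | h | h
        exacts [.inr (.inr (.inr (by omega))), .inl (by omega),
          .inr (.inr (.inl (by omega))), .inr (.inl (by omega))]
    · rintro _ ⟨a, x, y, d, rfl, h1, h⟩
      refine ⟨d, x, -y - d, a + 2 * y + d, ?_, by linear_combination h1, ?_⟩
      · rw [inv_gen₂_smul_circ]; push_cast; rfl
      · rcases h with h | h | h | h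
        exacts [.inr (.inl (by omega)), .inr (.inr (.inr (by omega))),
          .inr (.inr (.inl (by omega))), .inl (by omega)]

lemma stripPacking_subset_congruentToBase : stripPacking ⊆ congruentToBase := by
  intro C hC
  obtain ⟨γ, hγ, rfl⟩ := exists_smul_eq_of_mem_stripPacking hC
  have := MulAction.mem_stabilizer_iff.1 (Gam_le_stabilizer_congruentToBase hγ)
  rw [← this]
  refine Set.smul_mem_smul_set ⟨0, 0, 1, 0, ?_, by norm_num, by norm_num⟩
  rw [base₁_eq]; norm_num

/-- The line `Im z = -1` does not belong to the strip packing. -/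
lemma rot_smul_base₂_notMem : rot⁻¹ • base₂.1 ∉ circles stripPacking := by
  rintro ⟨C, hC, e⟩
  obtain ⟨a, x, y, d, rfl, h1, h⟩ := stripPacking_subset_congruentToBase hC
  rw [← Prod.smul_fst, base₂_eq, inv_rot_smul_circ] at e
  have h1' : discr ⟨a, x, y, d⟩ = 1 := by
    simp only [discr]; exact_mod_cast h1
  rcases eq_or_eq_neg_of_circ_fst_eq h1' (by norm_num [discr]) e with e | e
  · simp only [HForm.mk.injEq] at e
    obtain ⟨e1, e2, e3, e4⟩ := e
    have e3' : y = 1 := by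
      have : (y : ℝ) = 1 := by linarith
      exact_mod_cast this
    have e4' : d = 2 := by exact_mod_cast e4.symm
    omega
  · simp only [neg_mk, HForm.mk.injEq] at e
    obtain ⟨e1, e2, e3, e4⟩ := e
    have e3' : y = -1 := by
      have : (y : ℝ) = -1 := by linarith
      exact_mod_cast this
    have e4' : d = -2 := by
      have : (d : ℝ) = -2 := by linarith
      exact_mod_cast this
    omega

lemma circles_smul (g : PGL(2, GaussianInt)) (P : Set Pair) :
    circles (g • P) = g • circles P := by
  simp only [circles, ← Set.image_smul, Set.image_image, Prod.smul_fst]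

lemma stabilizer_le_stabilizer_circles (P : Set Pair) :
    MulAction.stabilizer PGL(2, GaussianInt) P ≤
      MulAction.stabilizer PGL(2, GaussianInt) (circles P) := by
  intro g hg
  rw [MulAction.mem_stabilizer_iff] at hg ⊢
  rw [← circles_smul, hg]

lemma smul_base₁_eq_or {g : PGL(2, GaussianInt)} {C : Pair} (hC : IsOrientedCircle C)
    (h : g • base₁.1 = C.1) : C = g • base₁ ∨ C = (g * rot⁻¹) • base₁ := by
  obtain ⟨k, h1, e⟩ := (isOrientedCircle_iff _).1 (isOrientedCircle_smul g⁻¹ hC)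
  have e1 : base₁.1 = k.circ.1 := by
    rw [← e, Prod.smul_fst, ← h, inv_smul_smul]
  rw [base₁_eq] at e1
  rcases eq_or_eq_neg_of_circ_fst_eq (by norm_num [discr]) h1 e1 with rfl | rfl
  · left
    rw [base₁_eq, ← e, smul_inv_smul]
  · right
    rw [mul_smul, base₁_eq, inv_rot_smul_circ, ← inv_smul_eq_iff, e]
    simp

lemma stabilizer_circles_stripPacking_le :
    MulAction.stabilizer PGL(2, GaussianInt) (circles stripPacking) ≤ Gam := by
  have hGam := Gam_le_stabilizer_stripPacking.trans (stabilizer_le_stabilizer_circles _)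
  intro g hg
  have hmem : g • base₁.1 ∈ circles stripPacking := by
    rw [← MulAction.mem_stabilizer_iff.1 hg]
    exact Set.smul_mem_smul_set ⟨_, base₁_mem, rfl⟩
  obtain ⟨C, hC, e⟩ := hmem
  obtain ⟨γ, hγ, rfl⟩ := exists_smul_eq_of_mem_stripPacking hC
  rcases smul_base₁_eq_or (isOrientedCircle_smul γ isTriple_base.1) e.symm with h | h
  · have := mem_Gam_of_smul_base₁ (g := γ⁻¹ * g) (by rw [mul_smul, ← h, inv_smul_smul])
    exact (Subgroup.mul_mem_cancel_left _ (inv_mem hγ)).1 this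
  · -- Otherwise `z ↦ -z` preserves the circles of the strip packing, but the image of `Im z = 1` is
    -- not one of them.
    have h' := mem_Gam_of_smul_base₁ (g := γ⁻¹ * (g * rot⁻¹)) (by rw [mul_smul, ← h, inv_smul_smul])
    have h'' := (Subgroup.mul_mem_cancel_left _ (inv_mem hγ)).1 h'
    have hrot := (Subgroup.mul_mem_cancel_left _ hg).1 (hGam h'')
    refine absurd ?_ rot_smul_base₂_notMem
    rw [← MulAction.mem_stabilizer_iff.1 hrot]
    exact Set.smul_mem_smul_set ⟨_, base₂_mem, rfl⟩

lemma stabilizer_stripPacking :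
    MulAction.stabilizer PGL(2, GaussianInt) stripPacking = Gam :=
  le_antisymm ((stabilizer_le_stabilizer_circles _).trans stabilizer_circles_stripPacking_le)
    Gam_le_stabilizer_stripPacking

lemma stabilizer_circles_stripPacking :
    MulAction.stabilizer PGL(2, GaussianInt) (circles stripPacking) = Gam :=
  le_antisymm stabilizer_circles_stripPacking_le
    (Gam_le_stabilizer_stripPacking.trans (stabilizer_le_stabilizer_circles _))

/-- Every packing of Gaussian circles is a translate of the strip packing. -/
lemma exists_eq_smul_stripPacking {P : Set Pair} (hP : IsApollonianPacking P)
    (hG : ∀ C ∈ P, IsGaussianCircle C.1) : ∃ g : PGL(2, GaussianInt), P = g • stripPacking := by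
  obtain ⟨A, B, C, ht, rfl⟩ := hP
  obtain ⟨g₁, hg₁⟩ := hG A (.seed (by simp))
  obtain ⟨g, rfl⟩ : ∃ g : PGL(2, GaussianInt), A = g • base₁ := by
    rcases smul_base₁_eq_or ht.1 hg₁.symm with h | h
    · exact ⟨_, h⟩
    · exact ⟨_, h⟩
  have ht' := isTriple_smul g⁻¹ ht
  rw [inv_smul_smul] at ht'
  obtain ⟨γ, -, e1, e2, e4⟩ := exists_mem_Gam_of_isTriple ht'
    (isGaussianCircle_smul g⁻¹ (hG B (.seed (by simp))))
    (isGaussianCircle_smul g⁻¹ (hG C (.seed (by simp))))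
  refine ⟨g * γ, ?_⟩
  rw [stripPacking_eq, smul_packing, Set.smul_set_insert, Set.smul_set_insert,
    Set.smul_set_singleton, mul_smul, mul_smul, mul_smul, e1, e2, e4, smul_inv_smul, smul_inv_smul]

end Apollonian

theorem mainTheorem7 :
    (∀ P : Set Apollonian.Pair, Apollonian.IsApollonianPacking P →
      (∀ C ∈ P, Apollonian.IsGaussianCircle C.1) →
      ∃ g : PGL(2, GaussianInt),
        MulAction.stabilizer PGL(2, GaussianInt) P =
          Apollonian.Gam.map (MulAut.conj g).toMonoidHom ∧
        MulAction.stabilizer PGL(2, GaussianInt) (Apollonian.circles P) =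
          Apollonian.Gam.map (MulAut.conj g).toMonoidHom) ∧
    Apollonian.IsDescartesQuadruple
      Apollonian.base₁ Apollonian.base₂ Apollonian.base₃ Apollonian.base₄ ∧
    Apollonian.IsApollonianPacking Apollonian.stripPacking ∧
    {C : Apollonian.Pair | ∃ γ ∈ Apollonian.Gam, C = γ • Apollonian.realLine} =
      Apollonian.stripPacking := by
  refine ⟨fun P hP hG ↦ ?_, Apollonian.isDescartesQuadruple_base,
    ⟨_, _, _, Apollonian.isTriple_base, Apollonian.stripPacking_eq⟩, ?_⟩
  · obtain ⟨g, rfl⟩ := Apollonian.exists_eq_smul_stripPacking hP hG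
    refine ⟨g, ?_, ?_⟩
    · rw [MulAction.stabilizer_smul_eq_stabilizer_map_conj, Apollonian.stabilizer_stripPacking]
    · rw [Apollonian.circles_smul, MulAction.stabilizer_smul_eq_stabilizer_map_conj,
        Apollonian.stabilizer_circles_stripPacking]
  · ext C
    constructor
    · rintro ⟨γ, hγ, rfl⟩
      exact Apollonian.smul_mem_of_mem_Gam hγ Apollonian.base₁_mem
    · exact Apollonian.exists_smul_eq_of_mem_stripPacking
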